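/- Number the vertices of the abstract icosahedron from $1$ to $12$. Let $A\le S_{12}$ be its combinatorial automorphism group, generated by $$a=(1,2)(3,4)(5,7)(6,8)(9,11)(10,12),\quad b=(1,10)(3,9)(2,12)(4,11)(5,6)(7,8),$$ $$c=(1,7)(2,3)(4,11)(5,12)(6,8)(9,10),\quad d=(1,12)(3,9)(2,10)(4,11)(5,7)(6,8);$$ here $d$ interchanges combinatorially opposite vertices, and the $30$ edges are the pairs in the $A$-orbit of $\{1,2\}$. A matrix $M\in\mathbb{R}^{3\times 12}$ is the coordinate matrix of an icosahedron if its columns $V_1,\dots,V_{12}$ are pairwise different, $V_1+\dots+V_{12}=0$, and $\|V_i-V_j\|=1$ (Euclidean norm) for every edge $\{i,j\}$; self-intersections are allowed. Its Gram matrix is $G=M^{\mathrm{tr}}M$. The icosahedron is $\langle d\rangle$-invariant if $G_{g(i),g(j)}=G_{i,j}$ for all $g\in\langle d\rangle$ and all $i,j$. Two icosahedra have the same isometry type if their Gram matrices are conjugate by a permutation matrix. **Proposition.** There exist $\varepsilon>0$ and a non-constant real-analytic map $\Phi:[0,\varepsilon)\to\mathbb{R}^{3\times 12}$ such that, for all but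 finitely many $t\in[0,\varepsilon)$, $\Phi(t)$ is the coordinate matrix of a $\langle d\rangle$-invariant icosahedron, and such that infinitely many isometry types occur among these icosahedra $\Phi(t)$. In particular, there exist infinitely many isometry types of $\langle d\rangle$-invariant icosahedra. -/

import Mathlib

namespace Icosahedra

/-- The vertices of the abstract icosahedron, usually numbered from 1 to 12, are the elements of
`Fin 12`; the element `i` stands for the vertex number `i + 1`.
The involution (1,2)(3,4)(5,7)(6,8)(9,11)(10,12). -/
def a : Equiv.Perm (Fin 12) :=
  Equiv.swap 0 1 * Equiv.swap 2 3 * Equiv.swap 4 6 * Equiv.swap 5 7 * Equiv.swap 8 10 *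
    Equiv.swap 9 11

/-- The involution (1,10)(3,9)(2,12)(4,11)(5,6)(7,8). -/
def b : Equiv.Perm (Fin 12) :=
  Equiv.swap 0 9 * Equiv.swap 2 8 * Equiv.swap 1 11 * Equiv.swap 3 10 * Equiv.swap 4 5 *
    Equiv.swap 6 7

/-- The involution (1,7)(2,3)(4,11)(5,12)(6,8)(9,10). -/
def c : Equiv.Perm (Fin 12) :=
  Equiv.swap 0 6 * Equiv.swap 1 2 * Equiv.swap 3 10 * Equiv.swap 4 11 * Equiv.swap 5 7 *
    Equiv.swap 8 9

/-- The involution (1,12)(3,9)(2,10)(4,11)(5,7)(6,8), which interchanges combinatorially opposite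
vertices. -/
def d : Equiv.Perm (Fin 12) :=
  Equiv.swap 0 11 * Equiv.swap 2 8 * Equiv.swap 1 9 * Equiv.swap 3 10 * Equiv.swap 4 6 *
    Equiv.swap 5 7

/-- The combinatorial automorphism group of the abstract icosahedron. -/
def A : Subgroup (Equiv.Perm (Fin 12)) := Subgroup.closure {a, b, c, d}

/-- The 30 edges of the abstract icosahedron: the orbit of the pair of the vertices
number 1 and 2 under the combinatorial automorphism group. -/
def edges : Set (Sym2 (Fin 12)) := {e | ∃ g ∈ A, e = s(g 0, g 1)}

/-- `M` is the coordinate matrix of an icosahedron: its columns are twelve different points of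
3-space, whose sum is 0, such that any two of them joined by an edge have Euclidean distance 1. -/
structure IsIcosahedron (M : Matrix (Fin 3) (Fin 12) ℝ) : Prop where
  edge_length : ∀ i j, s(i, j) ∈ edges → ∑ k, (M k i - M k j) ^ 2 = 1
  vertices_ne : ∀ i j, i ≠ j → M.col i ≠ M.col j
  sum_eq_zero : ∀ k, ∑ i, M k i = 0

/-- The Gram matrix of the columns of a coordinate matrix. -/
def gramMatrix (M : Matrix (Fin 3) (Fin 12) ℝ) : Matrix (Fin 12) (Fin 12) ℝ :=
  M.transpose * M

/-- `M` is the coordinate matrix of a `U`-invariant icosahedron: its Gram matrix `G` satisfies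
`G (g i) (g j) = G i j` for all `g` in `U`. -/
def IsInvariantIcosahedron (U : Subgroup (Equiv.Perm (Fin 12)))
    (M : Matrix (Fin 3) (Fin 12) ℝ) : Prop :=
  IsIcosahedron M ∧ ∀ g ∈ U, (gramMatrix M).submatrix g g = gramMatrix M

/-- Isometry of coordinate matrices: the Gram matrices are conjugate by a permutation matrix. -/
def isometrySetoid : Setoid (Matrix (Fin 3) (Fin 12) ℝ) where
  r M N := ∃ σ : Equiv.Perm (Fin 12), gramMatrix N = (gramMatrix M).submatrix σ σ
  iseqv :=
    { refl := fun _ => ⟨1, rfl⟩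
      symm := by
        rintro M N ⟨σ, h⟩
        refine ⟨σ⁻¹, ?_⟩
        rw [h]
        ext i j
        simp
      trans := by
        rintro M N P ⟨σ, h⟩ ⟨τ, k⟩
        refine ⟨σ * τ, ?_⟩
        rw [k, h]
        rfl }

/-- The isometry type of a coordinate matrix. -/
def isometryType (M : Matrix (Fin 3) (Fin 12) ℝ) : Quotient isometrySetoid :=
  Quotient.mk isometrySetoid M

end Icosahedra

/-! Let `d` act as the half-turn about the third axis. An invariant icosahedron is then given by six
points, that is by 18 coordinates, subject to 15 edge equations, one per `d`-orbit of edges. Fixing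
the translation along the axis and the rotation about it leaves one degree of freedom, so a curve of
solutions is to be expected.

The curve starts at an explicit solution `basePoint` in which vertices 0 and 7 coincide, as do 5 and
11. With the height difference t of points 0 and 1 as the eighteenth function, the Jacobian there is
invertible (`fderiv_edgeMap_basePoint_injective`), and the analytic inverse function theorem yields
`exists_curve`. For small t ≠ 0 the coinciding pairs separate. The squared distance of vertices 0
and 7 is continuous, zero at t = 0 and positive afterwards, so it takes infinitely many values,
while one isometry type allows only finitely many (`infinite_isometryType_image`). -/

open Filter Topology

/-- An analytic local right inverse of an analytic map between finite-dimensional spaces of the same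
dimension, at a point where the derivative is injective. -/
theorem exists_analyticAt_rightInverse {E F : Type*} [NormedAddCommGroup E] [NormedSpace ℝ E]
    [FiniteDimensional ℝ E] [NormedAddCommGroup F] [NormedSpace ℝ F] [FiniteDimensional ℝ F]
    (hEF : Module.finrank ℝ E = Module.finrank ℝ F) {f : E → F} {x : E} (hf : AnalyticAt ℝ f x)
    (hinj : ∀ v, fderiv ℝ f x v = 0 → v = 0) :
    ∃ g : F → E, g (f x) = x ∧ AnalyticAt ℝ g (f x) ∧ ∀ᶠ y in 𝓝 (f x), f (g y) = y := by
  have : CompleteSpace E := FiniteDimensional.complete ℝ E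
  have : CompleteSpace F := FiniteDimensional.complete ℝ F
  let e : E ≃L[ℝ] F := (LinearEquiv.ofInjectiveOfFinrankEq (fderiv ℝ f x : E →ₗ[ℝ] F)
    ((injective_iff_map_eq_zero _).2 hinj) hEF).toContinuousLinearEquiv
  have he : (e : E →L[ℝ] F) = fderiv ℝ f x := by
    ext v
    rfl
  have hfd : HasFDerivAt f (e : E →L[ℝ] F) x := by
    rw [he]
    exact hf.differentiableAt.hasFDerivAt
  -- The top exponent is `ω`, beyond `∞`, so this is analyticity and passes to the local inverse.
  have hc : ContDiffAt ℝ (⊤ : WithTop ℕ∞) f x := hf.contDiffAt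
  refine ⟨hc.localInverse hfd (by simp), hc.localInverse_apply_image hfd (by simp),
    (hc.to_localInverse hfd (by simp)).analyticAt,
    (hc.hasStrictFDerivAt' hfd (by simp)).eventually_right_inverse⟩

/-! ### Edges, their `d`-orbits and the half-turn model -/

namespace Icosahedra

/-- The adjacency relation of the abstract icosahedron, as a list of neighbours. -/
def neighbors : Fin 12 → List (Fin 12) :=
  ![[1, 2, 3, 4, 5], [0, 2, 3, 6, 7], [0, 1, 5, 6, 10], [0, 1, 4, 7, 8], [0, 3, 5, 8, 9],
    [0, 2, 4, 9, 10], [1, 2, 7, 10, 11], [1, 3, 6, 8, 11], [3, 4, 7, 9, 11], [4, 5, 8, 10, 11],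
    [2, 5, 6, 9, 11], [6, 7, 8, 9, 10]]

theorem mem_neighbors_apply_iff {g : Equiv.Perm (Fin 12)} (hg : g ∈ A) :
    ∀ i j, g j ∈ neighbors (g i) ↔ j ∈ neighbors i := by
  induction hg using Subgroup.closure_induction with
  | mem x hx =>
    rcases hx with rfl | rfl | rfl | rfl <;> decide +kernel
  | one => simp
  | mul x y _ _ hx hy => simp [hx, hy]
  | inv x _ hx =>
    intro i j
    rw [← hx]
    simp

/-- This inclusion suffices: unit length is then imposed on all pairs of neighbours. -/
theorem mem_neighbors_of_mem_edges {i j : Fin 12} (h : s(i, j) ∈ edges) : j ∈ neighbors i := by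
  obtain ⟨g, hg, h⟩ := h
  rw [Sym2.eq_iff] at h
  rcases h with ⟨rfl, rfl⟩ | ⟨rfl, rfl⟩
  · rw [mem_neighbors_apply_iff hg]
    decide
  · rw [mem_neighbors_apply_iff hg]
    decide

/-- Representatives of the `d`-orbits of edges. -/
def edgeRep : Fin 15 → Fin 12 × Fin 12 :=
  ![(0, 1), (0, 2), (0, 3), (0, 4), (0, 5), (1, 2), (1, 3), (1, 6), (1, 7), (2, 5), (2, 6), (2, 10),
    (3, 4), (3, 7), (4, 5)]

theorem exists_edgeRep : ∀ i j, j ∈ neighbors i → ∃ e, (i, j) = edgeRep e ∨ (j, i) = edgeRep e ∨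
    (d i, d j) = edgeRep e ∨ (d j, d i) = edgeRep e := by
  decide +kernel

/-- The representative of the `d`-orbit of a vertex, as an index into a list of six points. -/
def orbitRep : Fin 12 → Fin 6 := ![0, 2, 4, 3, 5, 1, 5, 1, 4, 2, 3, 0]

/-- The sign which the half-turn about the third axis puts in front of the first two coordinates
of a vertex. -/
def orbitSign : Fin 12 → ℝ := ![1, 1, 1, -1, -1, 1, 1, -1, -1, -1, 1, -1]

/-- The coordinate matrix whose columns are six given points and their images under the half-turn
about the third axis, arranged in such a way that the half-turn acts on the columns as `d`. -/
def halfTurnMatrix (x : Fin 6 → Fin 3 → ℝ) : Matrix (Fin 3) (Fin 12) ℝ :=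
  .of fun k i => (if k = 2 then 1 else orbitSign i) * x (orbitRep i) k

theorem orbitRep_d (i : Fin 12) : orbitRep (d i) = orbitRep i := by
  revert i
  decide +kernel

theorem orbitSign_d (i : Fin 12) : orbitSign (d i) = -orbitSign i := by
  have h : ∀ i, d i = (![11, 9, 8, 10, 6, 7, 4, 5, 2, 1, 3, 0] : Fin 12 → Fin 12) i := by
    decide +kernel
  rw [h]
  fin_cases i <;> simp [orbitSign]

theorem halfTurnMatrix_d (x : Fin 6 → Fin 3 → ℝ) (k : Fin 3) (i : Fin 12) :
    halfTurnMatrix x k (d i) = (if k = 2 then 1 else -1) * halfTurnMatrix x k i := by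
  simp only [halfTurnMatrix, Matrix.of_apply, orbitRep_d, orbitSign_d]
  split_ifs <;> ring

/-- The squared distance of two columns. -/
def sqDist (M : Matrix (Fin 3) (Fin 12) ℝ) (i j : Fin 12) : ℝ := ∑ k, (M k i - M k j) ^ 2

theorem sqDist_comm (M : Matrix (Fin 3) (Fin 12) ℝ) (i j : Fin 12) :
    sqDist M i j = sqDist M j i :=
  Finset.sum_congr rfl fun _ _ => by ring

theorem sqDist_halfTurnMatrix_d (x : Fin 6 → Fin 3 → ℝ) (i j : Fin 12) :
    sqDist (halfTurnMatrix x) (d i) (d j) = sqDist (halfTurnMatrix x) i j := by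
  refine Finset.sum_congr rfl fun k _ => ?_
  rw [halfTurnMatrix_d, halfTurnMatrix_d]
  split_ifs <;> ring

theorem gramMatrix_halfTurnMatrix_submatrix (x : Fin 6 → Fin 3 → ℝ) {g : Equiv.Perm (Fin 12)}
    (hg : g ∈ Subgroup.zpowers d) :
    (gramMatrix (halfTurnMatrix x)).submatrix g g = gramMatrix (halfTurnMatrix x) := by
  rw [Subgroup.zpowers_eq_closure] at hg
  have hd (i j) : gramMatrix (halfTurnMatrix x) (d i) (d j) = gramMatrix (halfTurnMatrix x) i j := by
    simp only [gramMatrix, Matrix.mul_apply, Matrix.transpose_apply, halfTurnMatrix_d]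
    refine Finset.sum_congr rfl fun k _ => ?_
    split_ifs <;> ring
  suffices ∀ i j, gramMatrix (halfTurnMatrix x) (g i) (g j) = gramMatrix (halfTurnMatrix x) i j from
    Matrix.ext this
  induction hg using Subgroup.closure_induction with
  | mem y hy =>
    rw [Set.mem_singleton_iff] at hy
    rwa [hy]
  | one => simp
  | mul y z _ _ hy hz => simp [hy, hz]
  | inv y _ hy =>
    intro i j
    rw [← hy]
    simp

/-- Sufficient conditions for six points and their images under the half-turn to be the vertices
of an invariant icosahedron. -/
theorem isInvariantIcosahedron_halfTurnMatrix {x : Fin 6 → Fin 3 → ℝ}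
    (hedge : ∀ e, sqDist (halfTurnMatrix x) (edgeRep e).1 (edgeRep e).2 = 1)
    (hne : ∀ i j, i ≠ j → (halfTurnMatrix x).col i ≠ (halfTurnMatrix x).col j)
    (hsum : ∑ m, x m 2 = 0) :
    IsInvariantIcosahedron (Subgroup.zpowers d) (halfTurnMatrix x) := by
  refine ⟨⟨fun i j hij => ?_, hne, fun k => ?_⟩, fun g hg => gramMatrix_halfTurnMatrix_submatrix x hg⟩
  · change sqDist (halfTurnMatrix x) i j = 1
    obtain ⟨e, he | he | he | he⟩ := exists_edgeRep i j (mem_neighbors_of_mem_edges hij)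
    · simpa [← he] using hedge e
    · simpa [← he, sqDist_comm _ j i] using hedge e
    · simpa [← he, sqDist_halfTurnMatrix_d] using hedge e
    · simpa [← he, sqDist_halfTurnMatrix_d, sqDist_comm _ j i] using hedge e
  · by_cases hk : k = 2
    · subst hk
      rw [Fin.sum_univ_six] at hsum
      simp [halfTurnMatrix, Fin.sum_univ_succ, orbitRep]
      linarith
    -- `d` permutes the columns and negates this coordinate, so the sum equals its own negative.
    · have h := Equiv.sum_comp d (fun i => halfTurnMatrix x k i)
      simp only [halfTurnMatrix_d, if_neg hk, neg_one_mul, Finset.sum_neg_distrib] at h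
      linarith

/-! ### The square system of 18 equations and its derivative -/

/-- The squared edge lengths and three normalizing coordinates of `halfTurnMatrix x`: the sum of the
third coordinates fixes the translation, the next one fixes the rotation about the third axis, and the
last one will be the parameter. -/
def edgeMap (x : Fin 6 → Fin 3 → ℝ) : Fin 15 ⊕ Fin 3 → ℝ :=
  Sum.elim (fun e => sqDist (halfTurnMatrix x) (edgeRep e).1 (edgeRep e).2)
    ![∑ m, x m 2, x 0 1 - x 1 1, x 0 2 - x 1 2]

theorem finrank_eq : Module.finrank ℝ (Fin 6 → Fin 3 → ℝ) =
    Module.finrank ℝ (Fin 15 ⊕ Fin 3 → ℝ) := by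
  simp [Module.finrank_pi_fintype]

theorem contDiff_halfTurnMatrix_apply (k : Fin 3) (i : Fin 12) {n : WithTop ℕ∞} :
    ContDiff ℝ n fun x => halfTurnMatrix x k i := by
  simp only [halfTurnMatrix, Matrix.of_apply]
  fun_prop

theorem analyticAt_edgeMap (x : Fin 6 → Fin 3 → ℝ) : AnalyticAt ℝ edgeMap x := by
  suffices ContDiff ℝ (⊤ : WithTop ℕ∞) edgeMap from this.contDiffAt.analyticAt
  refine contDiff_pi.2 fun e => ?_
  rcases e with e | e
  · simp only [edgeMap, Sum.elim_inl, sqDist]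
    exact ContDiff.sum fun k _ =>
      ((contDiff_halfTurnMatrix_apply k _).sub (contDiff_halfTurnMatrix_apply k _)).pow 2
  · fin_cases e <;> simp [edgeMap] <;> fun_prop

theorem halfTurnMatrix_add_smul (x v : Fin 6 → Fin 3 → ℝ) (t : ℝ) (k : Fin 3) (i : Fin 12) :
    halfTurnMatrix (x + t • v) k i = halfTurnMatrix x k i + t * halfTurnMatrix v k i := by
  simp only [halfTurnMatrix, Matrix.of_apply, Pi.add_apply, Pi.smul_apply, smul_eq_mul]
  ring

theorem hasDerivAt_edgeMap (x v : Fin 6 → Fin 3 → ℝ) (e : Fin 15 ⊕ Fin 3) :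
    HasDerivAt (fun t : ℝ => edgeMap (x + t • v) e) (fderiv ℝ edgeMap x v e) 0 := by
  have h1 : HasDerivAt (fun t : ℝ => x + t • v) v 0 := by
    simpa using ((hasDerivAt_id (0 : ℝ)).smul_const v).const_add x
  have h2 : HasFDerivAt edgeMap (fderiv ℝ edgeMap x) (x + (0 : ℝ) • v) := by
    simpa using (analyticAt_edgeMap x).differentiableAt.hasFDerivAt
  exact hasDerivAt_pi.1 (h2.comp_hasDerivAt 0 h1) e

theorem fderiv_edgeMap_inl (x v : Fin 6 → Fin 3 → ℝ) (e : Fin 15) :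
    fderiv ℝ edgeMap x v (.inl e) =
      2 * ∑ k, (halfTurnMatrix x k (edgeRep e).1 - halfTurnMatrix x k (edgeRep e).2) *
        (halfTurnMatrix v k (edgeRep e).1 - halfTurnMatrix v k (edgeRep e).2) := by
  refine (hasDerivAt_edgeMap x v (.inl e)).unique ?_
  simp only [edgeMap, Sum.elim_inl, sqDist, halfTurnMatrix_add_smul, Finset.mul_sum]
  refine HasDerivAt.fun_sum fun k _ => ?_
  generalize halfTurnMatrix x k (edgeRep e).1 = p, halfTurnMatrix x k (edgeRep e).2 = q,
    halfTurnMatrix v k (edgeRep e).1 = p', halfTurnMatrix v k (edgeRep e).2 = q'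
  have h := ((((hasDerivAt_id (0 : ℝ)).mul_const p').const_add p).sub
    (((hasDerivAt_id (0 : ℝ)).mul_const q').const_add q)).pow 2
  convert! h using 1
  simp
  ring

/-- The normalizing functions are linear, hence equal to their derivative. -/
theorem fderiv_edgeMap_inr (x v : Fin 6 → Fin 3 → ℝ) (e : Fin 3) :
    fderiv ℝ edgeMap x v (.inr e) = edgeMap v (.inr e) := by
  refine (hasDerivAt_edgeMap x v (.inr e)).unique ?_
  have h : (fun t : ℝ => edgeMap (x + t • v) (.inr e)) =
      fun t => edgeMap x (.inr e) + t * edgeMap v (.inr e) := by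
    funext t
    fin_cases e <;> simp [edgeMap, Fin.sum_univ_six] <;> ring
  rw [h]
  simpa using
    ((hasDerivAt_id (0 : ℝ)).mul_const (edgeMap v (.inr e))).const_add (edgeMap x (.inr e))

end Icosahedra

/-! ### The degenerate icosahedron and its invertible Jacobian -/

namespace Icosahedra

/-- A degenerate invariant icosahedron, in which two pairs of vertices coincide. -/
noncomputable def basePoint : Fin 6 → Fin 3 → ℝ :=
  ![![1 / 2, 0, -(7 * √23 / 72)], ![-(1 / 2), 0, -(7 * √23 / 72)],
    ![5 / 6, 1 / 2, 5 * √23 / 72], ![-(5 / 6), 1 / 2, 5 * √23 / 72],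
    ![0, 3 / 8 - √2 * √23 / 16, √23 / 36 + 3 * √2 / 16],
    ![0, 3 / 8 + √2 * √23 / 16, √23 / 36 - 3 * √2 / 16]]

/-- Call the six points A, B, C, D, P, Q. The mirror negating the first coordinate exchanges A with
B and C with D; P and Q are the two points of its plane at distance 1 from A, B, C and D. The value
5/6 makes PQ a unit length. -/
theorem edgeMap_basePoint : edgeMap basePoint = Sum.elim (fun _ => 1) 0 := by
  have hr : √2 ^ 2 = 2 := Real.sq_sqrt (by norm_num)
  have hs : √23 ^ 2 = 23 := Real.sq_sqrt (by norm_num)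
  ext e
  rcases e with e | e
  · fin_cases e <;>
    simp [edgeMap, sqDist, edgeRep, halfTurnMatrix, orbitRep, orbitSign, basePoint,
      Fin.sum_univ_three] <;> ring_nf <;> (try simp only [hr, hs]) <;> norm_num
  · fin_cases e <;> simp [edgeMap, basePoint, Fin.sum_univ_six]
    ring

set_option maxHeartbeats 1000000 in
theorem fderiv_edgeMap_basePoint_injective (v : Fin 6 → Fin 3 → ℝ)
    (hv : fderiv ℝ edgeMap basePoint v = 0) : v = 0 := by
  have hedge (e : Fin 15) := (fderiv_edgeMap_inl basePoint v e).symm.trans (congrFun hv (.inl e))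
  have hnorm (e : Fin 3) := (fderiv_edgeMap_inr basePoint v e).symm.trans (congrFun hv (.inr e))
  have g₁ := hnorm 0
  have g₂ := hnorm 1
  have g₃ := hnorm 2
  have eAC := hedge 0
  have eAP := hedge 1
  have eAD := hedge 2
  have eAQ := hedge 3
  have eAB := hedge 4
  have eCP := hedge 5
  have eCD := hedge 6
  have eCQ := hedge 7
  have eCB := hedge 8
  have eBP := hedge 9
  have ePQ := hedge 10
  have eDP := hedge 11
  have eDQ := hedge 12
  have eBD := hedge 13
  have eBQ := hedge 14
  clear hedge hnorm hv
  simp [edgeMap, edgeRep, halfTurnMatrix, orbitRep, orbitSign, basePoint,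
    Fin.sum_univ_three, Fin.sum_univ_six] at *
  have hr : √2 ^ 2 = 2 := Real.sq_sqrt (by norm_num)
  have hs : √23 ^ 2 = 23 := Real.sq_sqrt (by norm_num)
  have hr₀ : 0 < √2 := by positivity
  have hs₀ : 0 < √23 := by positivity
  generalize √2 = r at *
  generalize √23 = s at *
  -- The edge AB is parallel to the first axis, and the edge from C to the half-turned D to the
  -- second.
  have b₁ : v 1 0 = v 0 0 := by linarith
  have b₂ : v 1 1 = v 0 1 := by linarith
  have b₃ : v 1 2 = v 0 2 := by linarith
  have d₂ : v 3 1 = -v 2 1 := by linarith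
  simp only [b₁, b₂, b₃, d₂] at g₁ eAC eAP eAD eAQ eCP eCQ eCB eBP ePQ eDP eDQ eBD eBQ
  have p₁ : v 4 0 = v 0 0 := by linear_combination eBP - eAP
  have q₁ : v 5 0 = -v 0 0 := by linear_combination eAQ - eBQ
  have a₂ : v 0 1 = 0 := by linear_combination (eCB - eAC + eAD - eBD) / 2
  have a₁ : v 0 0 = 0 := by linear_combination 3 / 4 * (eCB - eAC - eAD + eBD)
  rw [a₂] at b₂
  rw [a₁] at b₁ p₁ q₁
  simp only [a₁, a₂, p₁, q₁] at eAP eAQ eCP eCQ eCB eDP eDQ eBD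
  -- `v 2 0 + v 3 0`, `v 2 2 - v 3 2` and `v 2 1` form the part of the motion of C and D that
  -- changes sign under the mirror. Differences of mirror-image edge equations isolate it and make
  -- it vanish.
  have hK : v 2 0 + v 3 0 = -3 * v 2 1 - s / 2 * (v 2 2 - v 3 2) := by
    linear_combination 3 * (eCB - eBD)
  have hN : v 2 2 - v 3 2 = 2 / 3 * s * v 2 1 := by
    linear_combination -(4 / 3) * r * (eCP - eDP - eCQ + eDQ) +
      (s * v 2 1 / 3 - (v 2 2 - v 3 2) / 2) * hr
  have c₂ : v 2 1 = 0 := by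
    linear_combination -(1 / 8) * (eCP - eDP - 5 / 6 * hK - (-(3 * s / 8) - 3 * r / 16) * hN) -
      v 2 1 / 32 * hs
  have hκ : v 2 0 - v 3 0 = -(s / 2) * (v 2 2 + v 3 2 - 2 * v 0 2) := by
    linear_combination 3 * (eCB + eBD)
  have hzp : 0 < s / 8 + 3 * r / 16 := by positivity
  have hrs : 3 * r < 2 * s :=
    lt_of_pow_lt_pow_left₀ 2 (by positivity) (by rw [mul_pow, mul_pow, hr, hs]; norm_num)
  have hzq : 0 < s / 8 - 3 * r / 16 := by linear_combination hrs / 16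
  -- Relative to the line AB, the points P and Q can only rotate about it. Their rates are σ and, up
  -- to the half-turn, τ; the edge PQ forces σ = τ.
  obtain ⟨σ, p₂⟩ : ∃ σ, v 4 1 = (s / 8 + 3 * r / 16) * σ :=
    ⟨v 4 1 / (s / 8 + 3 * r / 16), (mul_div_cancel₀ _ hzp.ne').symm⟩
  obtain ⟨τ, q₂⟩ : ∃ τ, v 5 1 = (s / 8 - 3 * r / 16) * τ :=
    ⟨v 5 1 / (s / 8 - 3 * r / 16), (mul_div_cancel₀ _ hzq.ne').symm⟩
  have p₃ : v 4 2 = v 0 2 - (3 / 8 - r * s / 16) * σ := by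
    refine mul_left_cancel₀ hzp.ne' ?_
    linear_combination eAP - (3 / 8 - r * s / 16) * p₂
  have q₃ : v 5 2 = v 0 2 - (3 / 8 + r * s / 16) * τ := by
    refine mul_left_cancel₀ hzq.ne' ?_
    linear_combination eAQ - (3 / 8 + r * s / 16) * q₂
  simp only [c₂, p₂, q₂, p₃, q₃] at eCP eCQ ePQ eDP eDQ g₁ hK hN
  obtain rfl : σ = τ := by
    refine mul_left_cancel₀ hr₀.ne' ?_
    linear_combination -2 * ePQ - r * (σ - τ) / 32 * hs
  -- Sums of mirror-image equations treat the remaining, mirror-symmetric part. Afterwards all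
  -- heights move equally, and `g₁` excludes this translation.
  have hm : v 2 2 + v 3 2 - 2 * v 0 2 = 0 := by
    refine mul_left_cancel₀ hs₀.ne' ?_
    linear_combination -(4 / 3) * (eCP + eDP + eCQ + eDQ - 5 / 3 * hκ)
  have hσ : σ = 0 := by
    refine mul_left_cancel₀ hr₀.ne' ?_
    linear_combination 3 / 4 * (eCQ + eDQ - eCP - eDP) - 9 / 32 * r * hm - σ * r / 32 * hs
  simp only [hσ, hm, mul_zero, sub_zero] at p₂ p₃ q₂ q₃ g₁ hκ hN hK
  have a₃ : v 0 2 = 0 := by linarith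
  have c₁ : v 2 0 = 0 := by linear_combination (hK + hκ - s / 2 * hN) / 2
  have d₁ : v 3 0 = 0 := by linear_combination (hK - hκ - s / 2 * hN) / 2
  have c₃ : v 2 2 = 0 := by linarith
  have d₃ : v 3 2 = 0 := by linarith
  ext i k
  fin_cases i <;> fin_cases k <;> simp [*]

end Icosahedra

/-! ### Separation of vertices, isometry types and the curve -/

namespace Icosahedra

set_option maxHeartbeats 2000000 in
theorem exists_halfTurnMatrix_basePoint_ne {i j : Fin 12} (hij : i ≠ j)
    (h07 : s(i, j) ≠ s(0, 7)) (h511 : s(i, j) ≠ s(5, 11)) :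
    ∃ k, halfTurnMatrix basePoint k i ≠ halfTurnMatrix basePoint k j := by
  have hr : √2 ^ 2 = 2 := Real.sq_sqrt (by norm_num)
  have hs : √23 ^ 2 = 23 := Real.sq_sqrt (by norm_num)
  have hr₀ : 0 < √2 := by positivity
  have hs₀ : 0 < √23 := by positivity
  -- This keeps the second coordinate of P nonzero, so that P differs from its half-turn image.
  have hrs : 6 < √2 * √23 := lt_of_pow_lt_pow_left₀ 2 (by positivity) (by
    rw [mul_pow, hr, hs]; norm_num)
  by_contra! h
  have h₀ := h 0
  have h₁ := h 1
  have h₂ := h 2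
  clear h
  fin_cases i <;> fin_cases j <;>
    first
    | exact hij rfl
    | exact h07 (by decide)
    | exact h511 (by decide)
    | simp [halfTurnMatrix, orbitRep, orbitSign, basePoint] at h₀ h₁ h₂ <;> linarith

/-- The isometry types of a continuous family of matrices are infinite in number if a squared
distance of columns vanishes at the start and nowhere else. -/
theorem infinite_isometryType_image {Φ : ℝ → Matrix (Fin 3) (Fin 12) ℝ} {ε : ℝ} (hε : 0 < ε)
    {i j : Fin 12} (hc : ContinuousOn (fun t => sqDist (Φ t) i j) (Set.Ico 0 ε))
    (h0 : sqDist (Φ 0) i j = 0) (hpos : ∀ t ∈ Set.Ioo 0 ε, 0 < sqDist (Φ t) i j) :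
    ((fun t => isometryType (Φ t)) '' Set.Ioo 0 ε).Infinite := by
  intro hfin
  have hsq (M : Matrix (Fin 3) (Fin 12) ℝ) : sqDist M i j =
      gramMatrix M i i - 2 * gramMatrix M i j + gramMatrix M j j := by
    simp only [sqDist, gramMatrix, Matrix.mul_apply, Matrix.transpose_apply, Fin.sum_univ_three]
    ring
  -- each isometry type contributes only finitely many values of the squared distance
  have hvals : ((fun t => sqDist (Φ t) i j) '' Set.Ioo 0 ε).Finite := by
    have hfib : ∀ q ∈ (fun t => isometryType (Φ t)) '' Set.Ioo 0 ε,
        {y | ∃ M, isometryType M = q ∧ y = sqDist M i j}.Finite := by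
      rintro q ⟨t, -, rfl⟩
      refine (Set.finite_range fun σ : Equiv.Perm (Fin 12) =>
        gramMatrix (Φ t) (σ i) (σ i) - 2 * gramMatrix (Φ t) (σ i) (σ j) +
          gramMatrix (Φ t) (σ j) (σ j)).subset ?_
      rintro y ⟨M, hM, rfl⟩
      obtain ⟨σ, hσ⟩ := Quotient.exact hM.symm
      exact ⟨σ, by simp [hsq, hσ]⟩
    refine (hfin.biUnion hfib).subset ?_
    rintro y ⟨t, ht, rfl⟩
    exact Set.mem_biUnion (Set.mem_image_of_mem _ ht) ⟨Φ t, rfl, rfl⟩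
  have hε2 : ε / 2 ∈ Set.Ioo 0 ε := ⟨by linarith, by linarith⟩
  -- By the intermediate value theorem, every value between 0 and the one at ε / 2 is attained.
  refine (Set.Ioo_infinite (hpos _ hε2)).mono ?_ hvals
  have hivt := intermediate_value_Icc hε2.1.le
    (hc.mono fun t ht => ⟨ht.1, ht.2.trans_lt hε2.2⟩)
  intro y hy
  obtain ⟨t, ht, rfl⟩ := hivt ⟨h0.trans_le hy.1.le, hy.2.le⟩
  refine ⟨t, ⟨ht.1.lt_of_ne ?_, ht.2.trans_lt hε2.2⟩, rfl⟩
  rintro rfl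
  exact hy.1.ne' h0

/-- The invariant icosahedra near the degenerate one form a curve, which is parametrized by the
distance of the third coordinates of two vertices coinciding in the degenerate one. -/
theorem exists_curve : ∃ ε > 0, ∃ γ : ℝ → Fin 6 → Fin 3 → ℝ,
    AnalyticOnNhd ℝ γ (Set.Ico 0 ε) ∧ γ 0 = basePoint ∧
      (∀ t ∈ Set.Ico 0 ε, edgeMap (γ t) = Sum.elim (fun _ => 1) ![0, 0, t]) ∧
      ∀ t ∈ Set.Ioo 0 ε, ∀ i j, i ≠ j →
        (halfTurnMatrix (γ t)).col i ≠ (halfTurnMatrix (γ t)).col j := by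
  obtain ⟨g, hg0, hga, hg⟩ := exists_analyticAt_rightInverse finrank_eq
    (analyticAt_edgeMap basePoint) fderiv_edgeMap_basePoint_injective
  rw [edgeMap_basePoint] at hg0 hga hg
  let y : ℝ → Fin 15 ⊕ Fin 3 → ℝ := fun t => Sum.elim (fun _ => 1) ![0, 0, t]
  have hy0 : y 0 = Sum.elim (fun _ => 1) 0 := by
    ext e
    rcases e with e | e
    · rfl
    · fin_cases e <;> rfl
  have hy : AnalyticAt ℝ y 0 := by
    suffices ContDiff ℝ (⊤ : WithTop ℕ∞) y from this.contDiffAt.analyticAt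
    refine contDiff_pi.2 fun e => ?_
    rcases e with e | e
    · exact contDiff_const
    · fin_cases e <;> simp [y] <;> fun_prop
  have hγ : AnalyticAt ℝ (fun t => g (y t)) 0 := AnalyticAt.fun_comp (by rwa [hy0]) hy
  have hright : ∀ᶠ t in 𝓝 (0 : ℝ), edgeMap (g (y t)) = y t :=
    hy.continuousAt.eventually (by rwa [hy0])
  have hcoord (k : Fin 3) (i : Fin 12) :
      ContinuousAt (fun t => halfTurnMatrix (g (y t)) k i) 0 :=
    (contDiff_halfTurnMatrix_apply (n := 0) k i).continuous.continuousAt.comp hγ.continuousAt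
  have hne : ∀ i j, i ≠ j → ∀ᶠ t in 𝓝 (0 : ℝ), t ≠ 0 →
      (halfTurnMatrix (g (y t))).col i ≠ (halfTurnMatrix (g (y t))).col j := by
    intro i j hij
    -- The half-turn preserves heights, so t is, up to sign, the height difference within each of
    -- the two coinciding pairs. All other pairs stay apart by continuity.
    have hflex : ∀ᶠ t in 𝓝 (0 : ℝ), t ≠ 0 → g (y t) 0 2 ≠ g (y t) 1 2 := by
      filter_upwards [hright] with t ht ht0 h
      have := congrFun ht (.inr 2)
      simp [edgeMap, y, h] at this
      exact ht0 this.symm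
    by_cases h07 : s(i, j) = s(0, 7)
    · filter_upwards [hflex] with t ht ht0 h
      rcases Sym2.eq_iff.1 h07 with ⟨rfl, rfl⟩ | ⟨rfl, rfl⟩
      · exact ht ht0 (by simpa [halfTurnMatrix, orbitRep] using congrFun h 2)
      · exact ht ht0 (by simpa [halfTurnMatrix, orbitRep] using (congrFun h 2).symm)
    by_cases h511 : s(i, j) = s(5, 11)
    · filter_upwards [hflex] with t ht ht0 h
      rcases Sym2.eq_iff.1 h511 with ⟨rfl, rfl⟩ | ⟨rfl, rfl⟩
      · exact ht ht0 (by simpa [halfTurnMatrix, orbitRep] using (congrFun h 2).symm)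
      · exact ht ht0 (by simpa [halfTurnMatrix, orbitRep] using congrFun h 2)
    obtain ⟨k, hk⟩ := exists_halfTurnMatrix_basePoint_ne hij h07 h511
    have hk0 : halfTurnMatrix (g (y 0)) k i ≠ halfTurnMatrix (g (y 0)) k j := by
      rwa [hy0, hg0]
    filter_upwards [((hcoord k i).sub (hcoord k j)).eventually_ne (sub_ne_zero.2 hk0)] with
      t ht _ h
    exact ht (sub_eq_zero.2 (congrFun h k))
  have hall : ∀ᶠ t in 𝓝 (0 : ℝ), ∀ i j, i ≠ j → t ≠ 0 →
      (halfTurnMatrix (g (y t))).col i ≠ (halfTurnMatrix (g (y t))).col j := by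
    simpa only [Filter.eventually_all] using hne
  obtain ⟨ε, hε, hball⟩ := Metric.eventually_nhds_iff.1
    (hγ.eventually_analyticAt.and (hright.and hall))
  have hdist {t : ℝ} (ht : t ∈ Set.Ico 0 ε) : dist t 0 < ε := by
    rw [Real.dist_eq, sub_zero, abs_of_nonneg ht.1]
    exact ht.2
  exact ⟨ε, hε, fun t => g (y t), fun t ht => (hball (hdist ht)).1,
    (congrArg g hy0).trans hg0,
    fun t ht => (hball (hdist ht)).2.1, fun t ht i j hij =>
      (hball (hdist ⟨ht.1.le, ht.2⟩)).2.2 i j hij ht.1.ne'⟩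

end Icosahedra

theorem proposition4p1 :
    (∃ ε : ℝ, 0 < ε ∧ ∃ Φ : ℝ → Matrix (Fin 3) (Fin 12) ℝ,
      -- `Φ` is real analytic on `[0, ε)`
      (∀ k i, AnalyticOnNhd ℝ (fun t => Φ t k i) (Set.Ico 0 ε)) ∧
      -- `Φ` is not constant on `[0, ε)`
      (∃ s ∈ Set.Ico 0 ε, ∃ t ∈ Set.Ico 0 ε, Φ s ≠ Φ t) ∧
      -- all but finitely many `Φ t` are coordinate matrices of invariant icosahedra
      {t ∈ Set.Ico 0 ε | ¬ Icosahedra.IsInvariantIcosahedron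
        (Subgroup.zpowers Icosahedra.d) (Φ t)}.Finite ∧
      -- infinitely many isometry types occur among these icosahedra
      {q | ∃ t ∈ Set.Ico 0 ε, Icosahedra.IsInvariantIcosahedron
        (Subgroup.zpowers Icosahedra.d) (Φ t) ∧ q = Icosahedra.isometryType (Φ t)}.Infinite) ∧
    -- there are infinitely many isometry types of invariant icosahedra
    {q | ∃ M, Icosahedra.IsInvariantIcosahedron (Subgroup.zpowers Icosahedra.d) M ∧
      q = Icosahedra.isometryType M}.Infinite := by
  obtain ⟨ε, hε, γ, hγa, hγ0, hγe, hγne⟩ := Icosahedra.exists_curve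
  let Φ : ℝ → Matrix (Fin 3) (Fin 12) ℝ := fun t => Icosahedra.halfTurnMatrix (γ t)
  have hΦa (k i) : AnalyticOnNhd ℝ (fun t => Φ t k i) (Set.Ico 0 ε) := fun t ht =>
    ((Icosahedra.contDiff_halfTurnMatrix_apply k i).contDiffAt.analyticAt).fun_comp (hγa t ht)
  have hΦ : ∀ t ∈ Set.Ioo 0 ε,
      Icosahedra.IsInvariantIcosahedron (Subgroup.zpowers Icosahedra.d) (Φ t) := fun t ht =>
    Icosahedra.isInvariantIcosahedron_halfTurnMatrix
      (fun e => congrFun (hγe t ⟨ht.1.le, ht.2⟩) (.inl e)) (hγne t ht)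
      (congrFun (hγe t ⟨ht.1.le, ht.2⟩) (.inr 0))
  have hdist0 : Icosahedra.sqDist (Φ 0) 0 7 = 0 := by
    simp [Φ, hγ0, Icosahedra.sqDist, Icosahedra.halfTurnMatrix, Icosahedra.orbitRep,
      Icosahedra.orbitSign, Icosahedra.basePoint, Fin.sum_univ_three]
  have hdist : ∀ t ∈ Set.Ioo 0 ε, 0 < Icosahedra.sqDist (Φ t) 0 7 := by
    intro t ht
    refine (Finset.sum_nonneg fun k _ => sq_nonneg _).lt_of_ne' fun h => ?_
    refine hγne t ht 0 7 (by decide) (funext fun k => sub_eq_zero.1 (pow_eq_zero_iff two_ne_zero |>.1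
      ((Finset.sum_eq_zero_iff_of_nonneg fun k _ => sq_nonneg _).1 h k (Finset.mem_univ k))))
  have hinf : {q | ∃ t ∈ Set.Ico 0 ε, Icosahedra.IsInvariantIcosahedron
      (Subgroup.zpowers Icosahedra.d) (Φ t) ∧ q = Icosahedra.isometryType (Φ t)}.Infinite := by
    refine (Icosahedra.infinite_isometryType_image hε ?_ hdist0 hdist).mono ?_
    · exact continuousOn_finsetSum _ fun k _ =>
        ((hΦa k 0).continuousOn.sub (hΦa k 7).continuousOn).pow 2
    · rintro q ⟨t, ht, rfl⟩
      exact ⟨t, ⟨ht.1.le, ht.2⟩, hΦ t ht, rfl⟩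
  refine ⟨⟨ε, hε, Φ, hΦa, ⟨0, ⟨le_rfl, hε⟩, ε / 2, ⟨by linarith, by linarith⟩, fun h => ?_⟩, ?_,
    hinf⟩, hinf.mono ?_⟩
  · have := hdist (ε / 2) ⟨by linarith, by linarith⟩
    rw [← h, hdist0] at this
    exact lt_irrefl 0 this
  -- The degenerate start t = 0 is the only possible exception.
  · refine (Set.finite_singleton (0 : ℝ)).subset ?_
    rintro t ⟨ht, hn⟩
    by_contra h
    exact hn (hΦ t ⟨ht.1.lt_of_ne' h, ht.2⟩)
  · rintro q ⟨t, -, h, rfl⟩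
    exact ⟨Φ t, h, rfl⟩
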